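/- For an integer $m\ge 0$ let $P_m$ be the space of complex homogeneous polynomials of degree $m$ in two variables $x_1,x_2$, with the inner product determined by $\langle x_1^{l}x_2^{m-l},x_1^{k}x_2^{m-k}\rangle=l!\,(m-l)!\,\delta_{lk}$, and let $\rho_m$ be the unitary representation of $SU(2)$ on $P_m$ given by $(\rho_m(g)f)(x_1,x_2)=f((x_1,x_2)g)$. A quantum channel $\Phi:\mathrm{End}(H)\to\mathrm{End}(K)$ between finite-dimensional Hilbert spaces is a completely positive trace-preserving linear map; its minimal output entropy is $S_{\min}(\Phi)=\min S(\Phi(ww^*))$, the minimum being over all unit vectors $w\in H$, where $S(\varrho)=-\mathrm{tr}(\varrho\log_2\varrho)$ (with $0\log_2 0=0$) is the von Neumann entropy. **Theorem.** Let $m\in\mathbb{N}$ with $m\ge 5$, and let $\Phi:\mathrm{End}(P_1)\to\mathrm{End}(P_m)$ be an $SU(2)$-covariant quantum channel, that is, $\Phi(\rho_1(g)A\rho_1(g)^*)=\rho_m(g)\Phi(A)\rho_m(g)^*$ for all $A\in\mathrm{End}(P_1)$ and $g\in SU(2)$. Then $$S_{\min}(\Phi)\;\ge\;\frac{1}{\ln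 2}\cdot\frac{(m-2)^2}{16\,m\,(m+1)^2}.$$ -/

import Mathlib

open scoped CStarAlgebra Nat InnerProductSpace

noncomputable section

namespace QuantumEntropy

/-! ## Quantum channels and minimal output entropy -/

section Channels

/-- The operator trace on a (finite-dimensional) Hilbert space. All Hilbert spaces below are
finite-dimensional, so that `H →L[ℂ] H` is the algebra of all linear endomorphisms of `H`. -/
def opTrace {H : Type*} [NormedAddCommGroup H] [InnerProductSpace ℂ H] (A : H →L[ℂ] H) : ℂ :=
  LinearMap.trace ℂ H (A : H →ₗ[ℂ] H)

/-- A quantum channel `End(H) → End(K)`: a completely positive trace preserving linear map. -/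
structure QuantumChannel (H K : Type*)
    [NormedAddCommGroup H] [InnerProductSpace ℂ H] [CompleteSpace H]
    [NormedAddCommGroup K] [InnerProductSpace ℂ K] [CompleteSpace K]
    extends (H →L[ℂ] H) →CP (K →L[ℂ] K) where
  trace_map : ∀ A : H →L[ℂ] H, opTrace (toLinearMap A) = opTrace A

/-- The von Neumann entropy `S(ϱ) = -tr(ϱ log₂ ϱ)`. The operator `ϱ log₂ ϱ` is obtained by
functional calculus from the continuous function `x ↦ x log₂ x` (with value `0` at `x = 0`). -/
def vonNeumannEntropy {H : Type*} [NormedAddCommGroup H] [InnerProductSpace ℂ H]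
    [CompleteSpace H] (ϱ : H →L[ℂ] H) : ℝ :=
  -(opTrace (cfc (fun x : ℝ => x * Real.logb 2 x) ϱ)).re

/-- The set `𝒫(H)` of pure states `w w*` of `H`, where `w` is a unit vector. -/
def pureStates (H : Type*) [NormedAddCommGroup H] [InnerProductSpace ℂ H] : Set (H →L[ℂ] H) :=
  {ϱ | ∃ w : H, ‖w‖ = 1 ∧ ϱ = InnerProductSpace.rankOne ℂ w w}

variable {H K : Type*}
  [NormedAddCommGroup H] [InnerProductSpace ℂ H] [CompleteSpace H]
  [NormedAddCommGroup K] [InnerProductSpace ℂ K] [CompleteSpace K]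

/-- The output entropies `S(Φ(ϱ))` of `Φ` at the pure states `ϱ`. -/
def pureOutputEntropies (Φ : QuantumChannel H K) : Set ℝ :=
  (fun ϱ => vonNeumannEntropy (Φ.toLinearMap ϱ)) '' pureStates H

/-- The minimal output entropy `S_min(Φ) = min {S(Φ(ϱ)) : ϱ a pure state of H}`.
The infimum is attained, see `isLeast_minOutputEntropy`. -/
def minOutputEntropy (Φ : QuantumChannel H K) : ℝ :=
  sInf (pureOutputEntropies Φ)

/-- `Φ` is covariant with respect to the actions `π` on `H` and `σ` on `K`:
`Φ(π(g) A π(g)*) = σ(g) Φ(A) σ(g)*`. -/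
def QuantumChannel.IsCovariant {G : Type*} [Monoid G] (Φ : QuantumChannel H K)
    (π : G →* (H →L[ℂ] H)) (σ : G →* (K →L[ℂ] K)) : Prop :=
  ∀ (g : G) (A : H →L[ℂ] H),
    Φ.toLinearMap (π g * A * star (π g)) = σ g * Φ.toLinearMap A * star (σ g)

/-- On a nonzero finite-dimensional Hilbert space the minimal output entropy is an actual
minimum over the pure states. -/
theorem isLeast_minOutputEntropy [FiniteDimensional ℂ H] [FiniteDimensional ℂ K] [Nontrivial H]
    (Φ : QuantumChannel H K) : IsLeast (pureOutputEntropies Φ) (minOutputEntropy Φ) := by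
  have hcompact : IsCompact (pureOutputEntropies Φ) := by
    have himg : pureOutputEntropies Φ =
        (fun w : H => vonNeumannEntropy (Φ.toLinearMap (InnerProductSpace.rankOne ℂ w w))) ''
          Metric.sphere 0 1 := by
      ext x
      simp only [pureOutputEntropies, pureStates, Set.mem_image, Set.mem_ofPred_eq,
        mem_sphere_zero_iff_norm]
      constructor
      · rintro ⟨ϱ, ⟨w, hw, rfl⟩, rfl⟩
        exact ⟨w, hw, rfl⟩
      · rintro ⟨w, hw, rfl⟩
        exact ⟨_, ⟨w, hw, rfl⟩, rfl⟩
    rw [himg]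
    have : ProperSpace H := FiniteDimensional.proper ℂ H
    refine (isCompact_sphere (0 : H) 1).image ?_
    have hΦ : Continuous Φ.toLinearMap := LinearMap.continuous_of_finiteDimensional _
    have hr : Continuous fun w : H => InnerProductSpace.rankOne ℂ w w := by
      simp only [InnerProductSpace.rankOne_def]
      fun_prop
    have hpos : ∀ w : H,
        IsSelfAdjoint (Φ.toLinearMap (InnerProductSpace.rankOne ℂ w w)) := by
      intro w
      have h0 : (0 : H →L[ℂ] H) ≤ InnerProductSpace.rankOne ℂ w w :=
        (ContinuousLinearMap.nonneg_iff_isPositive _).2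
          (InnerProductSpace.isPositive_rankOne_self w)
      have h2 : 0 ≤ Φ.toCompletelyPositiveMap (InnerProductSpace.rankOne ℂ w w) :=
        map_nonneg Φ.toCompletelyPositiveMap h0
      exact IsSelfAdjoint.of_nonneg h2
    have hlog : Continuous fun x : ℝ => x * Real.logb 2 x := by
      simpa [Real.logb, mul_div_assoc] using Real.continuous_mul_log.div_const (Real.log 2)
    have hcfc : Continuous fun w : H => cfc (fun x : ℝ => x * Real.logb 2 x)
        (Φ.toLinearMap (InnerProductSpace.rankOne ℂ w w)) := by
      refine Continuous.cfc_of_mem_nhdsSet (s := Set.univ) _ ?_ (hΦ.comp hr) hpos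
        hlog.continuousOn
      exact Filter.univ_mem
    have htr : Continuous fun A : K →L[ℂ] K => opTrace A := by
      have : Continuous ((LinearMap.trace ℂ K) ∘ₗ
          (ContinuousLinearMap.coeLM ℂ : (K →L[ℂ] K) →ₗ[ℂ] (K →ₗ[ℂ] K))) :=
        LinearMap.continuous_of_finiteDimensional _
      exact this
    exact (Complex.continuous_re.comp (htr.comp hcfc)).neg
  obtain ⟨v, hv⟩ := exists_norm_eq H (zero_le_one : (0 : ℝ) ≤ 1)
  exact hcompact.isLeast_sInf ⟨_, Set.mem_image_of_mem _ ⟨v, hv, rfl⟩⟩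

end Channels

/-! ## The representations of `SU(2)` on homogeneous polynomials -/

section SU2

/-- The space `P_m` of complex homogeneous polynomials of degree `m` in two variables
`x₁ = X 0`, `x₂ = X 1`. -/
def HomPoly (m : ℕ) : Type := MvPolynomial.homogeneousSubmodule (Fin 2) ℂ m

instance (m : ℕ) : AddCommGroup (HomPoly m) :=
  inferInstanceAs (AddCommGroup (MvPolynomial.homogeneousSubmodule (Fin 2) ℂ m))

instance (m : ℕ) : Module ℂ (HomPoly m) :=
  inferInstanceAs (Module ℂ (MvPolynomial.homogeneousSubmodule (Fin 2) ℂ m))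

/-- The group `SU(2)`. -/
abbrev SU2 : Type := Matrix.specialUnitaryGroup (Fin 2) ℂ

/-- The coefficient of `x₁ ^ l * x₂ ^ (m - l)` in `f ∈ P_m`, for `l ≤ m`. -/
def HomPoly.coeff {m : ℕ} (l : ℕ) (f : HomPoly m) : ℂ :=
  MvPolynomial.coeff (Finsupp.single 0 l + Finsupp.single 1 (m - l)) f.1

theorem HomPoly.coeff_add {m : ℕ} (l : ℕ) (f g : HomPoly m) :
    (f + g).coeff l = f.coeff l + g.coeff l :=
  MvPolynomial.coeff_add _ f.1 g.1

theorem HomPoly.coeff_smul {m : ℕ} (l : ℕ) (c : ℂ) (f : HomPoly m) :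
    (c • f).coeff l = c * f.coeff l :=
  MvPolynomial.coeff_smul _ c f.1

theorem HomPoly.eq_zero_of_coeff {m : ℕ} (f : HomPoly m)
    (h : ∀ l ∈ Finset.range (m + 1), f.coeff l = 0) : f = 0 := by
  apply Subtype.ext
  ext d
  change MvPolynomial.coeff d f.1 = 0
  by_contra hd
  have hdeg : d.degree = m := by
    have := (MvPolynomial.mem_homogeneousSubmodule m _).1 f.2 hd
    rwa [Finsupp.degree_eq_weight_one]
  rw [Finsupp.degree_eq_sum, Fin.sum_univ_two] at hdeg
  apply hd
  have hd' : d = Finsupp.single 0 (d 0) + Finsupp.single 1 (m - d 0) := by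
    ext i
    fin_cases i
    · simp
    · simp; omega
  rw [hd']
  exact h (d 0) (Finset.mem_range.2 (by omega))

/-- The inner product on `P_m` (conjugate linear in the first variable) determined by
`⟪x₁ ^ l x₂ ^ (m - l), x₁ ^ k x₂ ^ (m - k)⟫ = l! (m - l)! δ_{lk}`. -/
@[reducible] def HomPoly.innerCore (m : ℕ) : InnerProductSpace.Core ℂ (HomPoly m) where
  inner f g := ∑ l ∈ Finset.range (m + 1),
    ((l ! * (m - l)! : ℕ) : ℂ) * (starRingEnd ℂ (f.coeff l) * g.coeff l)
  conj_inner_symm f g := by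
    rw [map_sum]
    refine Finset.sum_congr rfl fun l _ => ?_
    rw [map_mul, map_mul, Complex.conj_conj, Complex.conj_natCast, mul_comm (g.coeff l)]
  re_inner_nonneg f := by
    rw [map_sum]
    refine Finset.sum_nonneg fun l _ => ?_
    rw [← Complex.normSq_eq_conj_mul_self, ← Complex.ofReal_natCast, ← Complex.ofReal_mul]
    exact mul_nonneg (Nat.cast_nonneg _) (Complex.normSq_nonneg _)
  add_left f g h := by
    rw [← Finset.sum_add_distrib]
    refine Finset.sum_congr rfl fun l _ => ?_
    rw [HomPoly.coeff_add, map_add]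
    ring
  smul_left f g r := by
    rw [Finset.mul_sum]
    refine Finset.sum_congr rfl fun l _ => ?_
    rw [HomPoly.coeff_smul, map_mul]
    ring
  definite f hf := by
    have h1 : ∑ l ∈ Finset.range (m + 1),
        ((l ! * (m - l)! : ℕ) : ℝ) * Complex.normSq (f.coeff l) = 0 := by
      have : ((∑ l ∈ Finset.range (m + 1),
          ((l ! * (m - l)! : ℕ) : ℝ) * Complex.normSq (f.coeff l) : ℝ) : ℂ) = 0 := by
        rw [← hf]
        push_cast
        refine Finset.sum_congr rfl fun l _ => ?_
        rw [← Complex.normSq_eq_conj_mul_self]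
      exact_mod_cast this
    rw [Finset.sum_eq_zero_iff_of_nonneg
      (fun l _ => mul_nonneg (Nat.cast_nonneg _) (Complex.normSq_nonneg _))] at h1
    refine f.eq_zero_of_coeff fun l hl => ?_
    have h2 := h1 l hl
    have h3 : ((l ! * (m - l)! : ℕ) : ℝ) ≠ 0 :=
      Nat.cast_ne_zero.2 (mul_ne_zero (Nat.factorial_ne_zero _) (Nat.factorial_ne_zero _))
    exact Complex.normSq_eq_zero.1 ((mul_eq_zero.1 h2).resolve_left h3)

instance (m : ℕ) : NormedAddCommGroup (HomPoly m) :=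
  @InnerProductSpace.Core.toNormedAddCommGroup ℂ _ _ _ _ (HomPoly.innerCore m)

instance (m : ℕ) : InnerProductSpace ℂ (HomPoly m) :=
  InnerProductSpace.ofCore (HomPoly.innerCore m).toCore

instance (m : ℕ) : FiniteDimensional ℂ (HomPoly m) :=
  Module.Finite.iff_fg.2 (MvPolynomial.homogeneousSubmodule_fg (σ := Fin 2) (R := ℂ) m)

instance (m : ℕ) : CompleteSpace (HomPoly m) := FiniteDimensional.complete ℂ _

/-- The substitution `f(x₁, x₂) ↦ f((x₁, x₂) g)`, that is `x_j ↦ ∑ i, g_{ij} x_i`. -/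
def subst (g : Matrix (Fin 2) (Fin 2) ℂ) :
    MvPolynomial (Fin 2) ℂ →ₐ[ℂ] MvPolynomial (Fin 2) ℂ :=
  MvPolynomial.aeval fun j => ∑ i, MvPolynomial.C (g i j) * MvPolynomial.X i

theorem subst_mem (g : Matrix (Fin 2) (Fin 2) ℂ) {m : ℕ} (f : MvPolynomial (Fin 2) ℂ)
    (hf : f ∈ MvPolynomial.homogeneousSubmodule (Fin 2) ℂ m) :
    subst g f ∈ MvPolynomial.homogeneousSubmodule (Fin 2) ℂ m := by
  rw [MvPolynomial.mem_homogeneousSubmodule] at hf ⊢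
  have := hf.aeval (fun j => ∑ i, MvPolynomial.C (g i j) * MvPolynomial.X i) (n := 1)
    fun j => MvPolynomial.IsHomogeneous.sum _ _ _ fun i _ =>
      MvPolynomial.isHomogeneous_C_mul_X _ _
  rwa [one_mul] at this

theorem subst_one (f : MvPolynomial (Fin 2) ℂ) : subst 1 f = f := by
  have : subst 1 = AlgHom.id ℂ _ := by
    ext j : 1
    simp [subst, Matrix.one_apply]
  rw [this, AlgHom.id_apply]

theorem subst_mul (g h : Matrix (Fin 2) (Fin 2) ℂ) (f : MvPolynomial (Fin 2) ℂ) :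
    subst (g * h) f = subst g (subst h f) := by
  have : subst (g * h) = (subst g).comp (subst h) := by
    ext j : 1
    simp only [subst, AlgHom.comp_apply, MvPolynomial.aeval_X, Matrix.mul_apply,
      Fin.sum_univ_two, map_add, map_mul, MvPolynomial.aeval_C, MvPolynomial.algebraMap_eq]
    ring
  rw [this, AlgHom.comp_apply]

/-- The substitution by `g` as a linear map `P_m → P_m`. -/
def substHom (m : ℕ) (g : Matrix (Fin 2) (Fin 2) ℂ) : HomPoly m →ₗ[ℂ] HomPoly m where
  toFun f := ⟨subst g f.1, subst_mem g f.1 f.2⟩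
  map_add' f h := Subtype.ext (map_add (subst g) f.1 h.1)
  map_smul' c f := Subtype.ext (map_smul (subst g) c f.1)

/-- The representation `ρ_m` of `SU(2)` on `P_m`, `(ρ_m(g) f)(x₁, x₂) = f((x₁, x₂) g)`. -/
def rho (m : ℕ) : SU2 →* (HomPoly m →L[ℂ] HomPoly m) where
  toFun g := LinearMap.toContinuousLinearMap (substHom m (g : Matrix (Fin 2) (Fin 2) ℂ))
  map_one' := by
    ext1 f
    exact Subtype.ext (subst_one _)
  map_mul' g h := by
    ext1 f
    exact Subtype.ext (subst_mul _ _ _)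

end SU2

end QuantumEntropy

end

/-! Covariance makes `Φ 1` commute with the irreducible `ρ_m`, so by Schur's lemma it is a scalar
`d`. Comparing traces on spaces of dimension `2` and `m + 1` gives `d = 2 / (m + 1)`. Since `w w* ≤
1` for a unit vector `w`, positivity of `Φ` gives `Φ(w w*) ≤ d`. All eigenvalues of the output are
thus at most `d`, and its entropy is at least `-log₂ d = log₂ ((m + 1) / 2)`
(`neg_logb_le_minOutputEntropy`), which for `m ≥ 5` is far above the stated bound.

The Schur step (`eq_smul_one_of_commute_rho`) is done by hand with coherent vectors, the `m`-th
powers of linear forms. The diagonal torus isolates the line of `x₁ ^ m`, so a commuting operator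
has it as an eigenvector; `SU(2)` and scaling carry `x₁ ^ m` to every coherent vector, and these
determine the operator. -/

noncomputable section

namespace QuantumEntropy

/-! ### Entropy bounds from an operator upper bound -/

section Entropy

variable {H K : Type*}
  [NormedAddCommGroup H] [InnerProductSpace ℂ H]
  [NormedAddCommGroup K] [InnerProductSpace ℂ K]

open scoped ComplexOrder in
theorem opTrace_mono [CompleteSpace H] [FiniteDimensional ℂ H] {A B : H →L[ℂ] H} (h : A ≤ B) :
    (opTrace A).re ≤ (opTrace B).re := by
  have h1 : (0 : ℂ) ≤ LinearMap.trace ℂ H ((B - A : H →L[ℂ] H) : H →ₗ[ℂ] H) :=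
    LinearMap.IsPositive.trace_nonneg
      (((ContinuousLinearMap.le_def A B).1 h).toLinearMap)
  have h2 : LinearMap.trace ℂ H ((B - A : H →L[ℂ] H) : H →ₗ[ℂ] H) = opTrace B - opTrace A := by
    rw [ContinuousLinearMap.toLinearMap_sub, map_sub]; rfl
  rw [h2] at h1
  have := (Complex.le_def.1 h1).1
  simpa using this

theorem opTrace_smul (c : ℂ) (A : H →L[ℂ] H) : opTrace (c • A) = c * opTrace A := by
  unfold opTrace
  rw [ContinuousLinearMap.toLinearMap_smul, map_smul, smul_eq_mul]

theorem opTrace_one [FiniteDimensional ℂ H] :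
    opTrace (1 : H →L[ℂ] H) = Module.finrank ℂ H := by
  unfold opTrace
  exact LinearMap.trace_one ℂ H

theorem opTrace_rankOne_self [FiniteDimensional ℂ H] {w : H} (hw : ‖w‖ = 1) :
    opTrace (InnerProductSpace.rankOne ℂ w w) = 1 := by
  unfold opTrace
  rw [InnerProductSpace.trace_rankOne, inner_self_eq_norm_sq_to_K, hw]
  simp

variable [CompleteSpace H] [CompleteSpace K]

theorem rankOne_self_le_one {w : H} (hw : ‖w‖ = 1) :
    InnerProductSpace.rankOne ℂ w w ≤ 1 :=
  (InnerProductSpace.isStarProjection_rankOne_self hw).le_one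

/-- A state bounded above by a multiple `d` of the identity has entropy at least `-log₂ d`. -/
theorem neg_logb_le_vonNeumannEntropy [FiniteDimensional ℂ H] {ϱ : H →L[ℂ] H} {d : ℝ}
    (h0 : 0 ≤ ϱ) (htr : opTrace ϱ = 1) (hd : ϱ ≤ algebraMap ℝ (H →L[ℂ] H) d) :
    -Real.logb 2 d ≤ vonNeumannEntropy ϱ := by
  have hsa : IsSelfAdjoint ϱ := IsSelfAdjoint.of_nonneg h0
  -- The spectrum lies in `[0, d]`, where `x log₂ x ≤ x log₂ d`; taking traces with `tr ϱ = 1` then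
  -- gives the claim.
  have hle : cfc (fun x : ℝ => x * Real.logb 2 x) ϱ ≤ cfc (fun x : ℝ => Real.logb 2 d * x) ϱ := by
    have hlog : Continuous fun x : ℝ => x * Real.logb 2 x := by
      simpa [Real.logb, mul_div_assoc] using Real.continuous_mul_log.div_const (Real.log 2)
    refine cfc_mono (fun x hx => ?_) hlog.continuousOn (by fun_prop)
    have hx0 : 0 ≤ x := spectrum_nonneg_of_nonneg h0 hx
    have hxd : x ≤ d := (le_algebraMap_iff_spectrum_le (R := ℝ)).1 hd x hx
    rcases hx0.eq_or_lt with rfl | hpos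
    · simp
    · rw [mul_comm]
      exact mul_le_mul_of_nonneg_right
        (Real.logb_le_logb_of_le (by norm_num) hpos hxd) hx0
  rw [cfc_const_mul_id (Real.logb 2 d) ϱ] at hle
  have h1 := opTrace_mono hle
  have h2 : (Real.logb 2 d • ϱ : H →L[ℂ] H) = ((Real.logb 2 d : ℝ) : ℂ) • ϱ := by
    ext x; simp
  rw [h2, opTrace_smul, htr, mul_one, Complex.ofReal_re] at h1
  unfold vonNeumannEntropy
  linarith

/-- If `Φ(1)` is a multiple `d` of the identity, then `S_min(Φ) ≥ -log₂ d`. -/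
theorem neg_logb_le_minOutputEntropy [FiniteDimensional ℂ H] [FiniteDimensional ℂ K]
    [Nontrivial H] (Φ : QuantumChannel H K) {d : ℝ}
    (hd : Φ.toLinearMap 1 = algebraMap ℝ (K →L[ℂ] K) d) :
    -Real.logb 2 d ≤ minOutputEntropy Φ := by
  obtain ⟨_, ⟨w, hw, rfl⟩, hS⟩ := (isLeast_minOutputEntropy Φ).1
  rw [← hS]
  have hpos : ∀ A : H →L[ℂ] H, 0 ≤ A → 0 ≤ Φ.toLinearMap A :=
    fun A hA => map_nonneg Φ.toCompletelyPositiveMap hA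
  refine neg_logb_le_vonNeumannEntropy (hpos _ ?_) ?_ ?_
  · exact (ContinuousLinearMap.nonneg_iff_isPositive _).2
      (InnerProductSpace.isPositive_rankOne_self w)
  · rw [Φ.trace_map, opTrace_rankOne_self hw]
  -- Positivity applied to `1 - w w*` gives `Φ(w w*) ≤ Φ(1)`.
  · have := hpos _ (sub_nonneg.2 (rankOne_self_le_one hw))
    rwa [map_sub, hd, sub_nonneg] at this

end Entropy

/-! ### Monomial coordinates and coherent vectors in `P_m` -/

section Polynomials

theorem single_add_single_injective {m k l : ℕ}
    (h : (Finsupp.single 0 k + Finsupp.single 1 (m - k) : Fin 2 →₀ ℕ) =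
      Finsupp.single 0 l + Finsupp.single 1 (m - l)) : k = l := by
  simpa using DFunLike.congr_fun h 0

theorem HomPoly.ext_coeff {m : ℕ} {f g : HomPoly m}
    (h : ∀ l ∈ Finset.range (m + 1), f.coeff l = g.coeff l) : f = g := by
  rw [← sub_eq_zero]
  refine HomPoly.eq_zero_of_coeff _ fun l hl => ?_
  have := HomPoly.coeff_add l g (f - g)
  rw [add_sub_cancel, h l hl] at this
  simpa using this

/-- The monomial `x₁ ^ l * x₂ ^ (m - l)`. -/
def HomPoly.mono (m : ℕ) (l : Fin (m + 1)) : HomPoly m :=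
  ⟨MvPolynomial.monomial (Finsupp.single 0 (l : ℕ) + Finsupp.single 1 (m - l)) 1,
    MvPolynomial.isHomogeneous_monomial _ (by
      rw [Finsupp.degree_eq_sum, Fin.sum_univ_two]
      simp; omega)⟩

theorem HomPoly.coeff_mono {m : ℕ} (l : Fin (m + 1)) (k : ℕ) :
    (HomPoly.mono m l).coeff k = if (l : ℕ) = k then 1 else 0 := by
  unfold HomPoly.coeff HomPoly.mono
  rw [MvPolynomial.coeff_monomial]
  refine if_congr ⟨single_add_single_injective, fun h => by rw [h]⟩ rfl rfl

/-- The coordinates of a homogeneous polynomial in the monomial basis. -/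
def HomPoly.coeffHom (m : ℕ) : HomPoly m →ₗ[ℂ] (Fin (m + 1) → ℂ) where
  toFun f l := f.coeff l
  map_add' f g := funext fun _ => HomPoly.coeff_add _ f g
  map_smul' c f := funext fun _ => HomPoly.coeff_smul _ c f

theorem HomPoly.coeffHom_sum (m : ℕ) (c : Fin (m + 1) → ℂ) :
    HomPoly.coeffHom m (∑ l, c l • HomPoly.mono m l) = c := by
  ext k
  rw [map_sum, Finset.sum_apply, Finset.sum_eq_single k]
  · simp [HomPoly.coeffHom, HomPoly.coeff_mono]
  · intro l _ hl
    simp [HomPoly.coeffHom, HomPoly.coeff_mono, Fin.val_inj, hl]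
  · simp

theorem HomPoly.coeffHom_injective (m : ℕ) : Function.Injective (HomPoly.coeffHom m) :=
  fun _ _ h => HomPoly.ext_coeff fun l hl => congrFun h ⟨l, Finset.mem_range.1 hl⟩

theorem HomPoly.finrank (m : ℕ) : Module.finrank ℂ (HomPoly m) = m + 1 := by
  rw [(LinearEquiv.ofBijective (HomPoly.coeffHom m)
    ⟨HomPoly.coeffHom_injective m, fun c => ⟨_, HomPoly.coeffHom_sum m c⟩⟩).finrank_eq]
  simp

theorem HomPoly.eq_sum_mono {m : ℕ} (f : HomPoly m) :
    f = ∑ l : Fin (m + 1), f.coeff l • HomPoly.mono m l :=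
  HomPoly.coeffHom_injective m (HomPoly.coeffHom_sum m _).symm

/-- Evaluation of a homogeneous polynomial at a point, as a linear functional. -/
def HomPoly.evalHom (m : ℕ) (a : Fin 2 → ℂ) : HomPoly m →ₗ[ℂ] ℂ where
  toFun f := MvPolynomial.eval a f.1
  map_add' f g := map_add (MvPolynomial.eval a) f.1 g.1
  map_smul' c f := MvPolynomial.smul_eval a f.1 c

theorem HomPoly.evalHom_eq_sum {m : ℕ} (a : Fin 2 → ℂ) (f : HomPoly m) :
    HomPoly.evalHom m a f =
      ∑ l ∈ Finset.range (m + 1), f.coeff l * (a 0 ^ l * a 1 ^ (m - l)) := by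
  conv_lhs => rw [f.eq_sum_mono]
  rw [map_sum, ← Fin.sum_univ_eq_sum_range
    (fun l => f.coeff l * (a 0 ^ l * a 1 ^ (m - l))) (m + 1)]
  refine Finset.sum_congr rfl fun l _ => ?_
  rw [map_smul, smul_eq_mul]
  congr 1
  change MvPolynomial.eval a (MvPolynomial.monomial _ 1) = _
  rw [MvPolynomial.eval_monomial, Finsupp.prod_fintype _ _ (by simp), Fin.prod_univ_two]
  simp

theorem HomPoly.ext_eval {m : ℕ} {f g : HomPoly m}
    (h : ∀ a, HomPoly.evalHom m a f = HomPoly.evalHom m a g) : f = g :=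
  Subtype.ext (MvPolynomial.funext h)

/-- The coherent vector `(v₁ x₁ + v₂ x₂) ^ m`. -/
def coherent (m : ℕ) (v : Fin 2 → ℂ) : HomPoly m :=
  ⟨(∑ j, MvPolynomial.C (v j) * MvPolynomial.X j) ^ m, by
    have := (MvPolynomial.IsHomogeneous.sum Finset.univ
      (fun j : Fin 2 => MvPolynomial.C (v j) * MvPolynomial.X j) 1
      fun j _ => MvPolynomial.isHomogeneous_C_mul_X _ _).pow m
    rwa [one_mul] at this⟩

theorem coeff_coherent {m l : ℕ} (hl : l ∈ Finset.range (m + 1)) (v : Fin 2 → ℂ) :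
    (coherent m v).coeff l = v 0 ^ l * v 1 ^ (m - l) * m.choose l := by
  have h1 : (coherent m v).1 = ∑ k ∈ Finset.range (m + 1),
      MvPolynomial.monomial (Finsupp.single 0 k + Finsupp.single 1 (m - k))
        (v 0 ^ k * v 1 ^ (m - k) * m.choose k) := by
    change (∑ j, MvPolynomial.C (v j) * MvPolynomial.X j) ^ m = _
    rw [Fin.sum_univ_two, add_pow]
    refine Finset.sum_congr rfl fun k _ => ?_
    rw [MvPolynomial.C_mul_X_eq_monomial, MvPolynomial.C_mul_X_eq_monomial,
      MvPolynomial.monomial_pow, MvPolynomial.monomial_pow, MvPolynomial.monomial_mul,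
      ← map_natCast MvPolynomial.C, mul_comm _ (MvPolynomial.C _), MvPolynomial.C_mul_monomial]
    congr 1
    · simp
    · ring
  unfold HomPoly.coeff
  rw [h1, MvPolynomial.coeff_sum, Finset.sum_eq_single l]
  · rw [MvPolynomial.coeff_monomial, if_pos rfl]
  · intro k _ hk
    rw [MvPolynomial.coeff_monomial, if_neg fun h => hk (single_add_single_injective h)]
  · exact fun h => absurd hl h

theorem coherent_smul (m : ℕ) (c : ℂ) (v : Fin 2 → ℂ) :
    coherent m (c • v) = c ^ m • coherent m v := by
  refine HomPoly.ext_coeff fun l hl => ?_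
  rw [HomPoly.coeff_smul, coeff_coherent hl, coeff_coherent hl]
  -- Only the exponent of `c ^ m` is to be split as `l + (m - l)`.
  nth_rewrite 3 [← Nat.add_sub_cancel' (Nat.lt_succ_iff.1 (Finset.mem_range.1 hl))]
  simp only [Pi.smul_apply, smul_eq_mul, mul_pow, pow_add]
  ring

/-- Reproducing property: the weight `l! (m - l)!` times the binomial coefficient of the coherent
vector is `m!` for every `l`. -/
theorem inner_coherent {m : ℕ} (v : Fin 2 → ℂ) (f : HomPoly m) :
    ⟪coherent m v, f⟫_ℂ = m ! * HomPoly.evalHom m (star v) f := by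
  rw [HomPoly.evalHom_eq_sum, Finset.mul_sum]
  change ∑ l ∈ Finset.range (m + 1), _ = _
  refine Finset.sum_congr rfl fun l hl => ?_
  rw [coeff_coherent hl, ← Nat.choose_mul_factorial_mul_factorial
    (Nat.lt_succ_iff.1 (Finset.mem_range.1 hl))]
  simp
  ring

/-- Coherent vectors are total, because a polynomial over `ℂ` is determined by its values. -/
theorem ext_inner_coherent {m : ℕ} {f g : HomPoly m}
    (h : ∀ v, ⟪coherent m v, f⟫_ℂ = ⟪coherent m v, g⟫_ℂ) : f = g := by
  refine HomPoly.ext_eval fun a => ?_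
  have := h (star a)
  rw [inner_coherent, inner_coherent, star_star] at this
  exact mul_left_cancel₀ (Nat.cast_ne_zero.2 (Nat.factorial_ne_zero m)) this

/-- An operator acting on all coherent vectors by the same scalar is a scalar. -/
theorem eq_smul_one_of_coherent {m : ℕ} {A : HomPoly m →L[ℂ] HomPoly m} {d : ℂ}
    (h : ∀ v, A (coherent m v) = d • coherent m v) : A = d • 1 := by
  -- The adjoint comes first: pairing `star A f` with a coherent vector moves `A` onto that vector,
  -- where it is known.
  have h1 : star A = star d • 1 := by
    ext1 f
    refine ext_inner_coherent fun v => ?_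
    rw [ContinuousLinearMap.star_eq_adjoint, ContinuousLinearMap.adjoint_inner_right, h,
      inner_smul_left]
    simp
  rw [← star_star A, h1, star_smul, star_star, star_one]

end Polynomials

/-! ### Unitarity and irreducibility of `ρ_m` -/

section Representation

theorem rho_apply_val {m : ℕ} (g : SU2) (f : HomPoly m) :
    (rho m g f).1 = subst (g : Matrix (Fin 2) (Fin 2) ℂ) f.1 := rfl

theorem rho_coherent {m : ℕ} (g : SU2) (v : Fin 2 → ℂ) :
    rho m g (coherent m v) =
      coherent m (Matrix.mulVec (g : Matrix (Fin 2) (Fin 2) ℂ) v) := by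
  apply Subtype.ext
  rw [rho_apply_val]
  change subst _ ((∑ j, MvPolynomial.C (v j) * MvPolynomial.X j) ^ m) =
    (∑ j, MvPolynomial.C (Matrix.mulVec (g : Matrix (Fin 2) (Fin 2) ℂ) v j) *
      MvPolynomial.X j) ^ m
  rw [map_pow]
  congr 1
  simp only [subst, Fin.sum_univ_two, map_add, map_mul, MvPolynomial.aeval_X,
    MvPolynomial.aeval_C, MvPolynomial.algebraMap_eq, Matrix.mulVec, dotProduct]
  ring

theorem evalHom_rho {m : ℕ} (g : SU2) (a : Fin 2 → ℂ) (f : HomPoly m) :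
    HomPoly.evalHom m a (rho m g f) =
      HomPoly.evalHom m (Matrix.vecMul a (g : Matrix (Fin 2) (Fin 2) ℂ)) f := by
  change MvPolynomial.eval a (subst (g : Matrix (Fin 2) (Fin 2) ℂ) f.1) =
    MvPolynomial.eval _ f.1
  have : (MvPolynomial.aeval a).comp (subst (g : Matrix (Fin 2) (Fin 2) ℂ)) =
      (MvPolynomial.aeval (Matrix.vecMul a (g : Matrix (Fin 2) (Fin 2) ℂ)) :
        MvPolynomial (Fin 2) ℂ →ₐ[ℂ] ℂ) := by
    ext j
    simp [subst, Matrix.vecMul, dotProduct, mul_comm]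
  simpa [MvPolynomial.aeval_def, MvPolynomial.eval₂_id] using DFunLike.congr_fun this f.1

/-- The representation `ρ_m` is unitary. -/
theorem star_rho (m : ℕ) (g : SU2) : star (rho m g) = rho m (star g) := by
  ext1 f
  refine ext_inner_coherent fun v => ?_
  rw [ContinuousLinearMap.star_eq_adjoint, ContinuousLinearMap.adjoint_inner_right,
    rho_coherent, inner_coherent, inner_coherent, evalHom_rho, Matrix.star_mulVec]
  rfl

theorem rho_mul_star (m : ℕ) (g : SU2) : rho m g * star (rho m g) = 1 := by
  rw [star_rho, ← map_mul]
  have : g * star g = 1 := Subtype.ext (Matrix.mem_unitaryGroup_iff.1 g.2.1)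
  rw [this, map_one]

theorem star_mul_rho (m : ℕ) (g : SU2) : star (rho m g) * rho m g = 1 := by
  rw [star_rho, ← map_mul]
  have : star g * g = 1 := Subtype.ext (Matrix.mem_unitaryGroup_iff'.1 g.2.1)
  rw [this, map_one]

/-- The element of `SU(2)` with first column `(a, b)`. -/
def su2OfColumn (a b : ℂ) (h : a * star a + b * star b = 1) : SU2 :=
  ⟨!![a, -star b; b, star a], by
    rw [Matrix.mem_specialUnitaryGroup_iff, Matrix.mem_unitaryGroup_iff']
    have h' : a * starRingEnd ℂ a + b * starRingEnd ℂ b = 1 := h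
    constructor
    · ext i j
      fin_cases i <;> fin_cases j <;>
        simp [Matrix.mul_apply, Fin.sum_univ_two, Matrix.star_apply] <;>
        first | ring1 | linear_combination h'
    · rw [Matrix.det_fin_two_of, ← h]; ring⟩

/-- The matrix is `diag(t, star t)`, for which the monomials are weight vectors. -/
theorem HomPoly.coeff_rho_diagonal {m : ℕ} (t : ℂ) (ht : t * star t + 0 * star 0 = 1)
    {l : ℕ} (hl : l ∈ Finset.range (m + 1)) (f : HomPoly m) :
    (rho m (su2OfColumn t 0 ht) f).coeff l = t ^ l * star t ^ (m - l) * f.coeff l := by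
  have hmono : ∀ k : Fin (m + 1), rho m (su2OfColumn t 0 ht) (HomPoly.mono m k) =
      (t ^ (k : ℕ) * star t ^ (m - k)) • HomPoly.mono m k := by
    intro k
    refine HomPoly.ext_eval fun a => ?_
    rw [evalHom_rho, map_smul, HomPoly.evalHom_eq_sum, HomPoly.evalHom_eq_sum, Finset.smul_sum]
    refine Finset.sum_congr rfl fun j _ => ?_
    rw [HomPoly.coeff_mono]
    split_ifs with hkj
    · subst hkj
      simp [su2OfColumn, Matrix.vecMul, dotProduct, Fin.sum_univ_two, mul_pow]
      ring
    · simp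
  have h := congrArg (fun F => HomPoly.coeffHom m F ⟨l, Finset.mem_range.1 hl⟩)
    (congrArg (rho m (su2OfColumn t 0 ht)) f.eq_sum_mono)
  change (rho m (su2OfColumn t 0 ht) f).coeff l = _ at h
  rw [h]
  simp only [map_sum (rho m _), map_smul (rho m _), hmono, smul_smul]
  rw [HomPoly.coeffHom_sum m fun k => f.coeff k * (t ^ (k : ℕ) * star t ^ (m - (k : ℕ)))]
  ring

/-- Operators commuting with `ρ_m` are scalars. -/
theorem eq_smul_one_of_commute_rho {m : ℕ} {A : HomPoly m →L[ℂ] HomPoly m}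
    (h : ∀ g, A * rho m g = rho m g * A) : ∃ d : ℂ, A = d • 1 := by
  have hA : ∀ g f, A (rho m g f) = rho m g (A f) := fun g f => DFunLike.congr_fun (h g) f
  set e : HomPoly m := coherent m ![1, 0] with he
  -- Here `e = x₁ ^ m`; the torus must rule out every other monomial in `A e`.
  obtain ⟨d, hd⟩ : ∃ d : ℂ, A e = d • e := by
    refine ⟨(A e).coeff m, HomPoly.ext_coeff fun l hl => ?_⟩
    rw [HomPoly.coeff_smul, he, coeff_coherent hl]
    rcases (Nat.lt_succ_iff.1 (Finset.mem_range.1 hl)).eq_or_lt with rfl | hlt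
    · simp
    have hne : m - l ≠ 0 := by omega
    have hz : (A e).coeff l = 0 := by
      -- One torus element suffices: a nonzero coefficient at `l < m` would force `t ^ (2 * (m - l))
      -- = 1`, but `0 < 2 * (m - l) < 2 * m + 1`, the order of `t`.
      have hprim := Complex.isPrimitiveRoot_exp (2 * m + 1) (by omega)
      set t : ℂ := Complex.exp (2 * Real.pi * Complex.I / (2 * m + 1 : ℕ)) with ht
      have hnorm : ‖t‖ = 1 := hprim.norm'_eq_one (by omega)
      have hts : t * star t = 1 := by
        rw [Complex.star_def, Complex.mul_conj, Complex.normSq_eq_norm_sq, hnorm]; simp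
      have ht0 : t * star t + 0 * star 0 = 1 := by rw [hts]; simp
      have hte : rho m (su2OfColumn t 0 ht0) e = t ^ m • e := by
        rw [he, rho_coherent]
        refine HomPoly.ext_coeff fun k hk => ?_
        rw [HomPoly.coeff_smul, coeff_coherent hk, coeff_coherent hk]
        rcases (Nat.lt_succ_iff.1 (Finset.mem_range.1 hk)).eq_or_lt with rfl | hlt
        · simp [su2OfColumn, Matrix.mulVec, dotProduct, Fin.sum_univ_two]
        · have : m - k ≠ 0 := by omega
          simp [su2OfColumn, Matrix.mulVec, dotProduct, Fin.sum_univ_two, this]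
      have h1 := hA (su2OfColumn t 0 ht0) e
      rw [hte, map_smul] at h1
      have h2 := congrArg (HomPoly.coeff l) h1
      rw [HomPoly.coeff_smul, HomPoly.coeff_rho_diagonal t ht0 hl] at h2
      by_contra hc
      have h3 := mul_right_cancel₀ hc h2
      have h4 : t ^ (2 * (m - l)) = 1 := by
        have hml : m = l + (m - l) := by omega
        have htl : t ^ l ≠ 0 := pow_ne_zero _ (left_ne_zero_of_mul_eq_one hts)
        have h5 : t ^ (m - l) = star t ^ (m - l) := by
          refine mul_left_cancel₀ htl ?_
          rw [← pow_add, ← hml, h3]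
        rw [two_mul, pow_add]
        nth_rewrite 2 [h5]
        rw [← mul_pow, hts, one_pow]
      have h6 := (hprim.pow_eq_one_iff_dvd _).1 h4
      have h7 := Nat.le_of_dvd (by omega) h6
      omega
    rw [hz]
    simp [hne]
  refine ⟨d, eq_smul_one_of_coherent fun v => ?_⟩
  -- Normalise `v` to a unit vector `u`; for `v = 0` take `c = 0` and an arbitrary `u`.
  obtain ⟨c, u, hu, rfl⟩ : ∃ (c : ℂ) (u : Fin 2 → ℂ),
      u 0 * star (u 0) + u 1 * star (u 1) = 1 ∧ v = c • u := by
    set r : ℝ := Complex.normSq (v 0) + Complex.normSq (v 1) with hr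
    have hv : v 0 * star (v 0) + v 1 * star (v 1) = r := by
      simp [hr, Complex.mul_conj]
    have h0 := Complex.normSq_nonneg (v 0)
    have h1 := Complex.normSq_nonneg (v 1)
    rcases eq_or_ne r 0 with hr0 | hr0
    · refine ⟨0, ![1, 0], by simp, ?_⟩
      have h2 : v 0 = 0 := Complex.normSq_eq_zero.1 (by linarith)
      have h3 : v 1 = 0 := Complex.normSq_eq_zero.1 (by linarith)
      ext i
      fin_cases i <;> simp [h2, h3]
    · have hs : √r ≠ 0 := (Real.sqrt_ne_zero (by positivity)).2 hr0
      have hs' : ((√r : ℝ) : ℂ) ≠ 0 := Complex.ofReal_ne_zero.2 hs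
      have hss : ((√r : ℝ) : ℂ) * (√r : ℝ) = r := by
        rw [← Complex.ofReal_mul, Real.mul_self_sqrt (by positivity)]
      refine ⟨(√r : ℝ), ((√r : ℝ) : ℂ)⁻¹ • v, ?_, (smul_inv_smul₀ hs' v).symm⟩
      simp only [Pi.smul_apply, smul_eq_mul, star_mul', star_inv₀, Complex.star_def,
        Complex.conj_ofReal] at hv ⊢
      field_simp
      rw [pow_two, hss, ← hv]
  -- `SU(2)` is transitive on unit vectors: the element with first column `u` sends `(1, 0)` to `u`.
  have hg : coherent m u = rho m (su2OfColumn (u 0) (u 1) hu) e := by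
    rw [he, rho_coherent]
    congr 1
    ext i
    fin_cases i <;> simp [su2OfColumn, Matrix.mulVec, dotProduct, Fin.sum_univ_two]
  rw [coherent_smul, map_smul, hg, hA, hd, map_smul, smul_comm]

end Representation

end QuantumEntropy

end

/-! ### The main bound -/

theorem mainTheorem4 (m : ℕ) (hm : 5 ≤ m)
    (Φ : QuantumEntropy.QuantumChannel (QuantumEntropy.HomPoly 1) (QuantumEntropy.HomPoly m))
    (hΦ : Φ.IsCovariant (QuantumEntropy.rho 1) (QuantumEntropy.rho m)) :
    1 / Real.log 2 * (((m : ℝ) - 2) ^ 2 / (16 * (m : ℝ) * ((m : ℝ) + 1) ^ 2)) ≤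
      QuantumEntropy.minOutputEntropy Φ := by
  have hcomm : ∀ g, Φ.toLinearMap 1 * QuantumEntropy.rho m g =
      QuantumEntropy.rho m g * Φ.toLinearMap 1 := by
    intro g
    -- By unitarity, covariance at the identity says that `Φ 1` is fixed under conjugation by
    -- `ρ_m(g)`.
    have h := hΦ g 1
    rw [mul_one, QuantumEntropy.rho_mul_star] at h
    nth_rewrite 1 [h]
    rw [mul_assoc, QuantumEntropy.star_mul_rho, mul_one]
  obtain ⟨c, hc⟩ := QuantumEntropy.eq_smul_one_of_commute_rho hcomm
  have hm0 : (m : ℂ) + 1 ≠ 0 := by exact_mod_cast Nat.succ_ne_zero m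
  have hcd : c = ((2 / (m + 1) : ℝ) : ℂ) := by
    have h := Φ.trace_map 1
    rw [hc, QuantumEntropy.opTrace_smul, QuantumEntropy.opTrace_one,
      QuantumEntropy.opTrace_one, QuantumEntropy.HomPoly.finrank,
      QuantumEntropy.HomPoly.finrank] at h
    push_cast at h ⊢
    rw [eq_div_iff hm0, h]
  have hd : Φ.toLinearMap 1 =
      algebraMap ℝ (QuantumEntropy.HomPoly m →L[ℂ] QuantumEntropy.HomPoly m) (2 / (m + 1)) := by
    rw [hc, hcd, Algebra.algebraMap_eq_smul_one]
    ext1 f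
    simp only [smul_apply]
    exact (RCLike.real_smul_eq_coe_smul (K := ℂ) _ _).symm
  have : Nontrivial (QuantumEntropy.HomPoly 1) :=
    Module.nontrivial_of_finrank_pos (R := ℂ) (by rw [QuantumEntropy.HomPoly.finrank]; norm_num)
  refine le_trans ?_ (QuantumEntropy.neg_logb_le_minOutputEntropy Φ hd)
  have hm5 : (5 : ℝ) ≤ m := by exact_mod_cast hm
  have hlog2 : 0 < Real.log 2 := Real.log_pos (by norm_num)
  -- Crude estimates suffice: `-ln d ≥ 1 - d ≥ 2 / 3`, while the target without its factor `1 / ln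
  -- 2` is at most `1 / 16`.
  have h1 : Real.log (2 / (m + 1)) ≤ 2 / ((m : ℝ) + 1) - 1 :=
    Real.log_le_sub_one_of_pos (by positivity)
  have h2 : 2 / ((m : ℝ) + 1) ≤ 1 / 3 := by
    rw [div_le_div_iff₀ (by positivity) (by norm_num)]; linarith
  have h3 : ((m : ℝ) - 2) ^ 2 / (16 * (m : ℝ) * ((m : ℝ) + 1) ^ 2) ≤ 1 / 16 := by
    rw [div_le_div_iff₀ (by positivity) (by norm_num)]
    nlinarith [mul_nonneg (sub_nonneg.2 hm5) (sq_nonneg ((m : ℝ) + 1))]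
  rw [Real.logb, ← neg_div, div_mul_eq_mul_div, one_mul]
  exact div_le_div_of_nonneg_right (by linarith) hlog2.le
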